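/- Let $a, b > 0$, and let $X_1, X_2, \ldots$ be i.i.d. random variables with the symmetric variance-gamma (generalized Laplace) distribution with location $m = 0$, shape $a$ and scale $b$, that is, with the law of $\sqrt{bG}\,Z$, where $G \sim \Gamma(a,1)$ (density $x^{a-1}e^{-x}/\Gamma(a)$, $x>0$) and $Z \sim \mathcal N(0,1)$ are independent. Put $$\hat V' = \frac1N\sum_{j=1}^N X_j^2, \qquad \hat K' = \frac1N\sum_{j=1}^N X_j^4, \qquad \hat a = \frac{3(\hat V')^2}{\hat K' - 3(\hat V')^2}, \qquad \hat b = \frac{\hat K'}{3\hat V'} - \hat V'.$$ Then, as $N \to \infty$, $\sqrt N\,[(\hat a,\hat b) - (a,b)]$ converges in distribution to the bivariate normal distribution $\mathcal N_2([0,0],\Sigma)$ with $$\Sigma = \frac13\begin{bmatrix} 2(4a^4+36a^3+95a^2+63a) & -2(4a^3+36a^2+101a+69)\,b \\ -2(4a^3+36a^2+101a+69)\,b & (8a^2+72a+220+159a^{-1})\,b^2 \end{bmatrix}$$ (in particular, this matrix is positive semidefinite). -/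

import Mathlib

open MeasureTheory ProbabilityTheory Filter

/-- The symmetric variance-gamma (generalized Laplace) distribution with location `m`, shape `a`
and scale `b`: the law of `m + √(b G) Z`, where `G` has the gamma distribution with shape `a` and
rate `1`, `Z` is standard normal, and `G` and `Z` are independent. -/
noncomputable def symmetricVarianceGamma (m a b : ℝ) : Measure ℝ :=
  ((gammaMeasure a 1).prod (gaussianReal 0 1)).map (fun p => m + √(b * p.1) * p.2)

/-- The raw (uncentered) empirical moment of order `k` of the first `N` observations. -/
noncomputable def empiricalRawMoment {Ω : Type*} (X : ℕ → Ω → ℝ) (k N : ℕ) (ω : Ω) : ℝ :=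
  (1 / (N : ℝ)) * ∑ i ∈ Finset.range N, X i ω ^ k

/-- The moment estimator of the shape parameter `a`: `3 V² / (K - 3 V²)`, with `V` and `K` the
raw empirical moments of orders two and four. -/
noncomputable def shapeEstimator {Ω : Type*} (X : ℕ → Ω → ℝ) (N : ℕ) (ω : Ω) : ℝ :=
  3 * empiricalRawMoment X 2 N ω ^ 2 /
    (empiricalRawMoment X 4 N ω - 3 * empiricalRawMoment X 2 N ω ^ 2)

/-- The moment estimator of the scale parameter `b`: `K / (3 V) - V`, with `V` and `K` the
raw empirical moments of orders two and four. -/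
noncomputable def scaleEstimator {Ω : Type*} (X : ℕ → Ω → ℝ) (N : ℕ) (ω : Ω) : ℝ :=
  empiricalRawMoment X 4 N ω / (3 * empiricalRawMoment X 2 N ω) - empiricalRawMoment X 2 N ω

/-- The limiting covariance matrix of the two estimators. -/
noncomputable def limitCovariance (a b : ℝ) : Matrix (Fin 2) (Fin 2) ℝ :=
  (1 / 3 : ℝ) •
    !![2 * (4 * a ^ 4 + 36 * a ^ 3 + 95 * a ^ 2 + 63 * a),
        -2 * (4 * a ^ 3 + 36 * a ^ 2 + 101 * a + 69) * b;
      -2 * (4 * a ^ 3 + 36 * a ^ 2 + 101 * a + 69) * b,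
        (8 * a ^ 2 + 72 * a + 220 + 159 / a) * b ^ 2]

/-!
The estimators are a smooth function of the average of the i.i.d. vectors `(X², X⁴)`. By the
Cramér–Wold device the average obeys the central limit theorem, and the delta method carries the
Gaussian limit through the map `(V, K) ↦ (3 V² / (K - 3 V²), K / (3 V) - V)`, turning the
covariance `S` of `(X², X⁴)` into `J S Jᵀ`, with `J` the Jacobian of this map at the true moments.
As `X² = b G Z²` with `G` and `Z` independent, the moment of order `2k` is
`b ^ k · a (a + 1) ⋯ (a + k - 1) · (2k - 1)‼`; the moments up to order eight give `S`, and
`J S Jᵀ` is the asserted covariance matrix, which is therefore positive semidefinite.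
-/

open scoped Topology RealInnerProductSpace Matrix

section DeltaMethod

variable {ι Ω Ω' : Type*} [MeasurableSpace Ω] [MeasurableSpace Ω'] {P : Measure Ω} {P' : Measure Ω'}
  {l : Filter ι}

lemma tendstoInMeasure_const_of_tendsto {E : Type*} [PseudoMetricSpace E] {u : ι → E} {c : E}
    (hu : Tendsto u l (𝓝 c)) : TendstoInMeasure P (fun n _ => u n) l fun _ => c := by
  refine tendstoInMeasure_iff_dist.2 fun ε hε => tendsto_const_nhds.congr' ?_
  filter_upwards [Metric.tendsto_nhds.1 hu ε hε] with n hn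
  simp [hn.not_ge]

lemma tendstoInMeasure_comp_of_continuousAt {E F : Type*} [PseudoMetricSpace E]
    [PseudoMetricSpace F] {T : ι → Ω → E} {θ : E} {φ : E → F}
    (hT : TendstoInMeasure P T l fun _ => θ) (hφ : ContinuousAt φ θ) :
    TendstoInMeasure P (fun n ω => φ (T n ω)) l fun _ => φ θ := by
  rw [tendstoInMeasure_iff_dist] at hT ⊢
  intro ε hε
  obtain ⟨δ, hδ, hφδ⟩ := Metric.continuousAt_iff.1 hφ ε hε
  refine tendsto_of_tendsto_of_tendsto_of_le_of_le tendsto_const_nhds (hT δ hδ)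
    (fun _ => zero_le) fun n => measure_mono fun ω hω => ?_
  exact le_of_not_gt fun hlt => (hφδ hlt).not_ge hω

variable [IsProbabilityMeasure P] [IsProbabilityMeasure P']

lemma tendstoInDistribution_of_identDistrib_limit {Ω'' E : Type*} [MeasurableSpace Ω'']
    {P'' : Measure Ω''} [IsProbabilityMeasure P''] [TopologicalSpace E] [MeasurableSpace E]
    [OpensMeasurableSpace E] {X : ι → Ω → E} {Z : Ω' → E} {W : Ω'' → E}
    (h : TendstoInDistribution X l Z (fun _ => P) P') (hZW : IdentDistrib Z W P' P'') :
    TendstoInDistribution X l W (fun _ => P) P'' where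
  forall_aemeasurable := h.forall_aemeasurable
  aemeasurable_limit := hZW.aemeasurable_snd
  tendsto := by simpa only [hZW.map_eq] using h.tendsto

lemma tendstoInMeasure_of_tendstoInDistribution_const {E : Type*} [PseudoMetricSpace E]
    [MeasurableSpace E] [OpensMeasurableSpace E] {X : ι → Ω → E} {c : E}
    (h : TendstoInDistribution X l (fun _ : Ω' => c) (fun _ => P) P') :
    TendstoInMeasure P X l fun _ => c := by
  refine tendstoInMeasure_iff_dist.2 fun ε hε => ?_
  have hclosed : IsClosed {y : E | ε ≤ dist y c} := isClosed_le (by fun_prop) (by fun_prop)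
  have hlimsup := ProbabilityMeasure.limsup_measure_closed_le_of_tendsto h.tendsto hclosed
  simp only [ProbabilityMeasure.coe_mk, Measure.map_const, measure_univ, one_smul,
    Measure.map_apply_of_aemeasurable (h.forall_aemeasurable _) hclosed.measurableSet] at hlimsup
  rw [Measure.dirac_apply' _ hclosed.measurableSet] at hlimsup
  have hzero : Set.indicator {y : E | ε ≤ dist y c} (1 : E → ENNReal) c = 0 := by simp [hε]
  exact tendsto_of_le_liminf_of_limsup_le bot_le (hlimsup.trans hzero.le)

variable {E : Type*} [NormedAddCommGroup E] [NormedSpace ℝ E] [SecondCountableTopology E]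
  [MeasurableSpace E] [BorelSpace E] [l.IsCountablyGenerated]
  {T : ι → Ω → E} {Z : Ω' → E} {r : ι → ℝ} {θ : E}

lemma tendstoInMeasure_of_tendstoInDistribution_smul_sub (hr : Tendsto r l atTop)
    (h : TendstoInDistribution (fun n ω => r n • (T n ω - θ)) l Z (fun _ => P) P') :
    TendstoInMeasure P T l fun _ => θ := by
  have hinv : TendstoInMeasure P (fun n (_ : Ω) => (r n)⁻¹) l fun _ => (0 : ℝ) :=
    tendstoInMeasure_const_of_tendsto (tendsto_inv_atTop_zero.comp hr)
  have hdist := h.continuous_comp_prodMk_of_tendstoInMeasure_const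
    (g := fun p : E × ℝ => p.2 • p.1 + θ) (by fun_prop) hinv fun _ => aemeasurable_const
  simp only [zero_smul, zero_add] at hdist
  refine (tendstoInMeasure_of_tendstoInDistribution_const hdist).congr' ?_ .rfl
  filter_upwards [hr.eventually_ne_atTop 0] with n hn
  exact ae_of_all _ fun ω => by simp [inv_smul_smul₀ hn]

theorem tendstoInDistribution_delta_method {F : Type*} [NormedAddCommGroup F]
    [NormedSpace ℝ F] [SecondCountableTopology F] [MeasurableSpace F] [BorelSpace F]
    {g : E → F} {A : E →L[ℝ] F} (hr : Tendsto r l atTop) (hT : ∀ n, AEMeasurable (T n) P)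
    (h : TendstoInDistribution (fun n ω => r n • (T n ω - θ)) l Z (fun _ => P) P')
    (hgm : Measurable g) (hg : HasFDerivAt g A θ) :
    TendstoInDistribution (fun n ω => r n • (g (T n ω) - g θ)) l (A ∘ Z) (fun _ => P) P' := by
  set ρ : E → ℝ := fun y => ‖y - θ‖⁻¹ * ‖g y - g θ - A (y - θ)‖ with hρ
  have hρθ : ρ θ = 0 := by simp [hρ]
  have hρm : Measurable ρ := by fun_prop
  have hρc : ContinuousAt ρ θ := by
    rw [ContinuousAt, hρθ]
    exact hasFDerivAt_iff_tendsto.1 hg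
  have hρT : TendstoInMeasure P (fun n ω => ρ (T n ω)) l fun _ => 0 := by
    simpa only [hρθ] using tendstoInMeasure_comp_of_continuousAt
      (tendstoInMeasure_of_tendstoInDistribution_smul_sub hr h) hρc
  have hnorm := h.continuous_comp_prodMk_of_tendstoInMeasure_const
    (g := fun p : E × ℝ => ‖p.1‖ * p.2) (by fun_prop) hρT
    fun n => hρm.comp_aemeasurable (hT n)
  simp only [mul_zero] at hnorm
  have hremainder := tendstoInMeasure_of_tendstoInDistribution_const hnorm
  refine tendstoInDistribution_of_tendstoInMeasure_sub _ _ (h.continuous_comp A.continuous) ?_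
    fun n => (((hgm.sub_const (g θ)).const_smul (r n)).comp_aemeasurable (hT n))
  rw [tendstoInMeasure_iff_norm] at hremainder ⊢
  refine fun ε hε => (hremainder ε hε).congr fun n => congrArg P (Set.ext fun ω => ?_)
  have hcancel : ‖T n ω - θ‖ * ρ (T n ω) = ‖g (T n ω) - g θ - A (T n ω - θ)‖ := by
    rcases eq_or_ne (T n ω) θ with hθ | hθ
    · simp [hθ]
    · exact mul_inv_cancel_left₀ (norm_ne_zero_iff.2 (sub_ne_zero.2 hθ)) _
  have hnorm_eq : ‖r n • (T n ω - θ)‖ * ρ (T n ω) =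
      ‖r n • (g (T n ω) - g θ) - A (r n • (T n ω - θ))‖ := by
    rw [norm_smul, mul_assoc, hcancel, ← norm_smul, smul_sub, map_smul]
  simp only [Set.mem_ofPred_eq, hnorm_eq, sub_zero, norm_norm, Pi.sub_apply, Pi.zero_apply,
    Function.comp_apply]

end DeltaMethod

section CentralLimit

lemma inv_sqrt_smul_sub_eq {E : Type*} [AddCommGroup E] [Module ℝ E] (n : ℕ) (s c : E) :
    (√n)⁻¹ • (s - (n : ℝ) • c) = √n • ((n : ℝ)⁻¹ • s - c) := by
  rw [smul_sub, smul_sub, smul_smul, smul_smul, ← div_eq_mul_inv, Real.sqrt_div_self,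
    inv_mul_eq_div, Real.div_sqrt]

variable {Ω Ω' E : Type*} [MeasurableSpace Ω] [MeasurableSpace Ω'] {P : Measure Ω} {P' : Measure Ω'}
  [NormedAddCommGroup E] [InnerProductSpace ℝ E] [MeasurableSpace E] [BorelSpace E]

lemma charFun_map_eq_charFun_map_inner {X : Ω → E} (hX : AEMeasurable X P) (t : E) :
    charFun (P.map X) t = charFun (P.map fun ω => ⟪t, X ω⟫) 1 := by
  rw [charFun_eq_charFunDual_toDualMap, charFunDual_eq_charFun_map_one,
    AEMeasurable.map_map_of_aemeasurable (by fun_prop) hX]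
  rfl

variable [FiniteDimensional ℝ E] [IsProbabilityMeasure P] [IsProbabilityMeasure P']

lemma tendstoInDistribution_of_forall_inner {X : ℕ → Ω → E} {Z : Ω' → E}
    (hX : ∀ n, AEMeasurable (X n) P) (hZ : AEMeasurable Z P')
    (h : ∀ t, TendstoInDistribution (fun n ω => ⟪t, X n ω⟫) atTop (fun ω => ⟪t, Z ω⟫)
      (fun _ => P) P') :
    TendstoInDistribution X atTop Z (fun _ => P) P' where
  forall_aemeasurable := hX
  aemeasurable_limit := hZ
  tendsto := by
    refine ProbabilityMeasure.tendsto_iff_tendsto_charFun.2 fun t => ?_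
    have ht := ProbabilityMeasure.tendsto_iff_tendsto_charFun.1 (h t).tendsto 1
    simpa only [ProbabilityMeasure.coe_mk, charFun_map_eq_charFun_map_inner (hX _),
      charFun_map_eq_charFun_map_inner hZ] using ht

lemma covarianceBilin_map_self {X : Ω → E} (hX : MemLp X 2 P) (t : E) :
    covarianceBilin (P.map X) t t = Var[fun ω => ⟪t, X ω⟫; P] := by
  have hXm := hX.aestronglyMeasurable.aemeasurable
  have : IsProbabilityMeasure (P.map X) := Measure.isProbabilityMeasure_map hXm
  rw [covarianceBilin_self ((memLp_map_measure_iff (by fun_prop) hXm).2 hX),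
    variance_map (by fun_prop) hXm]
  rfl

theorem tendstoInDistribution_sqrt_smul_average_sub {Y : ℕ → Ω → E} {Z : Ω' → E}
    (hY : MemLp (Y 0) 2 P) (hindep : iIndepFun Y P) (hident : ∀ i, IdentDistrib (Y i) (Y 0) P P)
    (hZ : HasGaussianLaw Z P') (hZmean : P'[Z] = 0)
    (hZcov : covarianceBilin (P'.map Z) = covarianceBilin (P.map (Y 0))) :
    TendstoInDistribution
      (fun (n : ℕ) ω => √(n : ℝ) • ((n : ℝ)⁻¹ • ∑ k ∈ Finset.range n, Y k ω - P[Y 0]))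
      atTop Z (fun _ => P) P' := by
  have hYm (k : ℕ) : AEMeasurable (Y k) P := (hident k).aemeasurable_fst
  have (n : ℕ) : AEMeasurable (fun ω => ∑ k ∈ Finset.range n, Y k ω) P :=
    Finset.aemeasurable_fun_sum _ fun k _ => hYm k
  refine tendstoInDistribution_of_forall_inner (fun n => by fun_prop) hZ.aemeasurable fun t => ?_
  have hinner : Measurable fun y : E => ⟪t, y⟫ := by fun_prop
  have hmean : ∫ ω, ⟪t, Z ω⟫ ∂P' = 0 := by
    rw [integral_inner hZ.integrable, hZmean, inner_zero_right]
  have hvar : Var[fun ω => ⟪t, Z ω⟫; P'] = Var[fun ω => ⟪t, Y 0 ω⟫; P] := by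
    rw [← covarianceBilin_map_self hZ.memLp_two, hZcov, covarianceBilin_map_self hY]
  have hmap : P'.map (fun ω => ⟪t, Z ω⟫) = gaussianReal 0 Var[fun ω => ⟪t, Y 0 ω⟫; P].toNNReal := by
    rw [← hvar, ← hmean]
    exact (hZ.map_fun (innerSL ℝ t)).map_eq_gaussianReal
  have hclt := tendstoInDistribution_inv_sqrt_mul_sum_sub
    (X := fun k ω => ⟪t, Y k ω⟫) ⟨hinner.comp_aemeasurable hZ.aemeasurable, hmap⟩ (hY.const_inner t)
    (hindep.comp (fun _ y => ⟪t, y⟫) fun _ => hinner) fun i => (hident i).comp hinner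
  simpa only [← inv_sqrt_smul_sub_eq, Function.comp_def, real_inner_smul_right, inner_sub_right,
    inner_sum, integral_inner (hY.integrable one_le_two)] using hclt

end CentralLimit

section Covariance

variable {ι κ Ω : Type*} [MeasurableSpace Ω] {μ : Measure Ω}

/-- The covariance matrix of a family of real random variables. -/
noncomputable def covarianceMatrix (X : ι → Ω → ℝ) (μ : Measure Ω) : Matrix ι ι ℝ :=
  .of fun i j => cov[X i, X j; μ]

lemma covarianceBilin_map_toLp [Fintype ι] [IsFiniteMeasure μ] {X : ι → Ω → ℝ}
    (hX : ∀ i, MemLp (X i) 2 μ) (x y : EuclideanSpace ℝ ι) :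
    covarianceBilin (μ.map fun ω => WithLp.toLp 2 fun i => X i ω) x y =
      x ⬝ᵥ covarianceMatrix X μ *ᵥ y := by
  simp only [covarianceBilin_apply_pi hX, covarianceMatrix, dotProduct, Matrix.mulVec,
    Matrix.of_apply, Finset.mul_sum]
  exact Finset.sum_congr rfl fun i _ => Finset.sum_congr rfl fun j _ => by ring

lemma posSemidef_covarianceMatrix [Finite ι] [IsFiniteMeasure μ] {X : ι → Ω → ℝ}
    (hX : ∀ i, MemLp (X i) 2 μ) : (covarianceMatrix X μ).PosSemidef := by
  have := Fintype.ofFinite ι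
  refine .of_dotProduct_mulVec_nonneg ?_ fun x => ?_
  · ext i j
    exact covariance_comm (X j) (X i)
  · rw [star_trivial, ← covarianceBilin_map_toLp hX (WithLp.toLp 2 x) (WithLp.toLp 2 x)]
    exact covarianceBilin_self_nonneg _

lemma map_toEuclideanLin_multivariateGaussian [Fintype ι] [DecidableEq ι] [Fintype κ]
    [DecidableEq κ] {S : Matrix ι ι ℝ} (hS : S.PosSemidef) (m : EuclideanSpace ℝ ι)
    (J : Matrix κ ι ℝ) :
    (multivariateGaussian m S).map J.toEuclideanLin =
      multivariateGaussian (J.toEuclideanLin m) (J * S * Jᵀ) := by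
  have hS' : (J * S * Jᵀ).PosSemidef := by
    simpa using hS.mul_mul_conjTranspose_same J
  have hadjoint : ContinuousLinearMap.adjoint J.toEuclideanLin.toContinuousLinearMap =
      Jᵀ.toEuclideanLin.toContinuousLinearMap := by
    rw [← Matrix.conjTranspose_eq_transpose_of_trivial,
      Matrix.toEuclideanLin_conjTranspose_eq_adjoint]
    rfl
  change (multivariateGaussian m S).map J.toEuclideanLin.toContinuousLinearMap = _
  refine IsGaussian.ext ?_ ?_
  · simp only [id_eq]
    rw [ContinuousLinearMap.integral_id_map IsGaussian.integrable_id,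
      integral_id_multivariateGaussian, integral_id_multivariateGaussian]
    rfl
  · ext x y
    rw [covarianceBilin_map IsGaussian.memLp_two_id, covarianceBilin_multivariateGaussian hS,
      covarianceBilin_multivariateGaussian hS', hadjoint]
    simp [Matrix.toLpLin_apply, ← Matrix.mulVec_mulVec, Matrix.dotProduct_mulVec x J,
      ← Matrix.mulVec_transpose]

end Covariance

section MethodOfMoments

variable {Ω 𝓧 ι κ : Type*}

/-- The vector of averages of a family of real statistics over the first `N` observations. -/
noncomputable def empiricalMean (f : ι → 𝓧 → ℝ) (X : ℕ → Ω → 𝓧) (N : ℕ) (ω : Ω) :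
    EuclideanSpace ℝ ι :=
  WithLp.toLp 2 fun i => (N : ℝ)⁻¹ * ∑ k ∈ Finset.range N, f i (X k ω)

variable [MeasurableSpace Ω] [MeasurableSpace 𝓧]

/-- The vector of expectations of a family of real statistics under a law. -/
noncomputable def meanVector (f : ι → 𝓧 → ℝ) (μ : Measure 𝓧) : EuclideanSpace ℝ ι :=
  WithLp.toLp 2 fun i => ∫ x, f i x ∂μ

variable {P : Measure Ω} {μ : Measure 𝓧} {f : ι → 𝓧 → ℝ} {X : ℕ → Ω → 𝓧}

lemma aemeasurable_empiricalMean [Countable ι] (hf : ∀ i, Measurable (f i))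
    (hX : ∀ k, AEMeasurable (X k) P) (N : ℕ) : AEMeasurable (empiricalMean f X N) P := by
  have hsum (i : ι) : AEMeasurable (fun ω => ∑ k ∈ Finset.range N, f i (X k ω)) P :=
    Finset.aemeasurable_fun_sum _ fun k _ => (hf i).comp_aemeasurable (hX k)
  exact (by fun_prop : Measurable (WithLp.toLp 2)).comp_aemeasurable
    (aemeasurable_pi_lambda _ fun i => (hsum i).const_mul _)

variable [Fintype ι]

lemma integral_toLp_eq_meanVector [IsFiniteMeasure μ] (hL : ∀ i, MemLp (f i) 2 μ) :
    ∫ x, (WithLp.toLp 2 fun i => f i x : EuclideanSpace ℝ ι) ∂μ = meanVector f μ := by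
  ext i
  exact eval_integral_piLp (f := fun x => WithLp.toLp 2 fun i => f i x)
    (fun i => (hL i).integrable one_le_two) i

variable [DecidableEq ι] [IsProbabilityMeasure P]

theorem tendstoInDistribution_sqrt_smul_empiricalMean_sub (hf : ∀ i, Measurable (f i))
    (hL : ∀ i, MemLp (f i) 2 μ) (hindep : iIndepFun X P) (hlaw : ∀ k, HasLaw (X k) μ P) :
    TendstoInDistribution
      (fun (N : ℕ) ω => √(N : ℝ) • (empiricalMean f X N ω - meanVector f μ))
      atTop id (fun _ => P) (multivariateGaussian 0 (covarianceMatrix f μ)) := by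
  have : IsProbabilityMeasure μ := (hlaw 0).isProbabilityMeasure_iff.1 ‹_›
  set φ : 𝓧 → EuclideanSpace ℝ ι := fun x => WithLp.toLp 2 fun i => f i x
  have hφ : Measurable φ := by fun_prop
  have hφX : HasLaw (φ ∘ X 0) (μ.map φ) P :=
    (hφ.measurePreserving μ).comp_hasLaw (hlaw 0)
  have hφL : MemLp φ 2 μ := .of_eval_piLp hL
  have hmean : P[φ ∘ X 0] = meanVector f μ :=
    ((hlaw 0).integral_comp hφL.aestronglyMeasurable).trans (integral_toLp_eq_meanVector hL)
  have hcov : covarianceBilin ((multivariateGaussian 0 (covarianceMatrix f μ)).map id) =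
      covarianceBilin (P.map (φ ∘ X 0)) := by
    ext x y
    rw [Measure.map_id, hφX.map_eq, covarianceBilin_map_toLp hL,
      covarianceBilin_multivariateGaussian (posSemidef_covarianceMatrix hL)]
  have hclt := tendstoInDistribution_sqrt_smul_average_sub (Y := fun k => φ ∘ X k) (Z := id)
    (((hlaw 0).map_eq.symm ▸ hφL).comp_of_map (hlaw 0).aemeasurable)
    (hindep.comp (fun _ => φ) fun _ => hφ)
    (fun k => ((hlaw k).identDistrib (hlaw 0)).comp hφ) HasLaw.id.hasGaussianLaw
    integral_id_multivariateGaussian hcov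
  have havg (N : ℕ) (ω : Ω) :
      (N : ℝ)⁻¹ • ∑ k ∈ Finset.range N, (φ ∘ X k) ω = empiricalMean f X N ω := by
    ext i
    simp [φ, empiricalMean]
  simpa only [hmean, havg] using hclt

theorem tendstoInDistribution_sqrt_smul_comp_empiricalMean_sub [Fintype κ] [DecidableEq κ]
    {g : EuclideanSpace ℝ ι → EuclideanSpace ℝ κ} {J : Matrix κ ι ℝ}
    (hf : ∀ i, Measurable (f i)) (hL : ∀ i, MemLp (f i) 2 μ) (hindep : iIndepFun X P)
    (hlaw : ∀ k, HasLaw (X k) μ P) (hg : Measurable g)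
    (hg' : HasFDerivAt g J.toEuclideanLin.toContinuousLinearMap (meanVector f μ)) :
    TendstoInDistribution
      (fun (N : ℕ) ω => √(N : ℝ) • (g (empiricalMean f X N ω) - g (meanVector f μ)))
      atTop id (fun _ => P) (multivariateGaussian 0 (J * covarianceMatrix f μ * Jᵀ)) := by
  have : IsProbabilityMeasure μ := (hlaw 0).isProbabilityMeasure_iff.1 ‹_›
  have hsqrt : Tendsto (fun N : ℕ => √(N : ℝ)) atTop atTop :=
    Real.tendsto_sqrt_atTop.comp tendsto_natCast_atTop_atTop
  have hdelta := tendstoInDistribution_delta_method hsqrt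
    (aemeasurable_empiricalMean hf fun k => (hlaw k).aemeasurable)
    (tendstoInDistribution_sqrt_smul_empiricalMean_sub hf hL hindep hlaw) hg hg'
  refine tendstoInDistribution_of_identDistrib_limit hdelta
    ⟨hdelta.aemeasurable_limit, aemeasurable_id, ?_⟩
  have hJ := map_toEuclideanLin_multivariateGaussian (posSemidef_covarianceMatrix hL) 0 J
  rw [map_zero] at hJ
  rw [Measure.map_id]
  exact hJ

end MethodOfMoments

section Moments

open scoped Nat

lemma integrable_pow_gaussianReal (μ : ℝ) (v : NNReal) (n : ℕ) :
    Integrable (fun x : ℝ => x ^ n) (gaussianReal μ v) :=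
  (memLp_id_gaussianReal (n : NNReal)).integrable_norm_pow'.mono (by fun_prop)
    (ae_of_all _ fun x => by simp)

lemma setIntegral_Ioi_even_pow_mul_exp_neg_sq {v : ℝ} (hv : 0 < v) (k : ℕ) :
    ∫ x in Set.Ioi (0 : ℝ), x ^ (2 * k) * Real.exp (-x ^ 2 / (2 * v)) =
      v ^ k * (2 * k - 1)‼ * √(2 * Real.pi * v) / 2 := by
  have hexponent : ((2 * k : ℕ) + 1 : ℝ) / 2 = k + 1 / 2 := by push_cast; ring
  have hpower : (2 * v)⁻¹ ^ (-((2 * k : ℕ) + 1 : ℝ) / 2) = (2 * v) ^ k * √(2 * v) := by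
    rw [neg_div, hexponent, Real.inv_rpow (by positivity), Real.rpow_neg (by positivity), inv_inv,
      Real.rpow_add (by positivity), Real.rpow_natCast, Real.sqrt_eq_rpow]
  calc ∫ x in Set.Ioi (0 : ℝ), x ^ (2 * k) * Real.exp (-x ^ 2 / (2 * v))
      = ∫ x in Set.Ioi (0 : ℝ),
          x ^ ((2 * k : ℕ) : ℝ) * Real.exp (-(2 * v)⁻¹ * x ^ (2 : ℝ)) := by
        refine setIntegral_congr_fun measurableSet_Ioi fun x _ => ?_
        simp only [Real.rpow_natCast, Real.rpow_ofNat]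
        ring_nf
    _ = (2 * v) ^ k * √(2 * v) * (1 / 2) * ((2 * k - 1)‼ * √Real.pi / 2 ^ k) := by
        rw [integral_rpow_mul_exp_neg_mul_rpow two_pos
          (by linarith [(Nat.cast_nonneg (2 * k) : (0 : ℝ) ≤ _)]) (by positivity), hpower,
          hexponent, Real.Gamma_nat_add_half]
    _ = v ^ k * (2 * k - 1)‼ * √(2 * Real.pi * v) / 2 := by
        rw [show 2 * Real.pi * v = 2 * v * Real.pi by ring, Real.sqrt_mul (by positivity) Real.pi]
        field_simp
        ring

lemma integral_even_pow_gaussianReal (v : NNReal) (k : ℕ) :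
    ∫ x, x ^ (2 * k) ∂(gaussianReal 0 v) = v ^ k * (2 * k - 1)‼ := by
  rcases eq_or_ne v 0 with rfl | hv
  · rcases k.eq_zero_or_pos with rfl | hk
    · simp
    · simp [hk.ne']
  have hv' : (0 : ℝ) < v := by positivity
  calc ∫ x, x ^ (2 * k) ∂(gaussianReal 0 v)
      = ∫ x : ℝ, (√(2 * Real.pi * v))⁻¹ * (|x| ^ (2 * k) * Real.exp (-|x| ^ 2 / (2 * v))) := by
        rw [integral_gaussianReal_eq_integral_smul hv]
        refine integral_congr_ae (ae_of_all _ fun x => ?_)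
        simp only [gaussianPDFReal, sub_zero, smul_eq_mul, pow_mul, sq_abs]
        ring
    _ = (√(2 * Real.pi * v))⁻¹ *
          (2 * ∫ x in Set.Ioi (0 : ℝ), x ^ (2 * k) * Real.exp (-x ^ 2 / (2 * v))) := by
        rw [integral_const_mul,
          integral_comp_abs (f := fun x => x ^ (2 * k) * Real.exp (-x ^ 2 / (2 * v)))]
    _ = v ^ k * (2 * k - 1)‼ := by
        rw [setIntegral_Ioi_even_pow_mul_exp_neg_sq hv']
        field_simp

lemma Gamma_add_natCast_eq_ascPochhammer_mul {a : ℝ} (ha : 0 < a) (k : ℕ) :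
    Real.Gamma (a + k) = (ascPochhammer ℝ k).eval a * Real.Gamma a := by
  induction k with
  | zero => simp
  | succ k ih =>
    rw [Nat.cast_succ, ← add_assoc, Real.Gamma_add_one (by positivity), ih,
      ascPochhammer_succ_eval]
    ring

lemma gammaPDF_mul_ofReal_pow {a r x : ℝ} (ha : 0 < a) (hr : 0 < r) (hx : x ≠ 0) (k : ℕ) :
    gammaPDF a r x * ENNReal.ofReal (x ^ k) =
      ENNReal.ofReal ((ascPochhammer ℝ k).eval a / r ^ k) * gammaPDF (a + k) r x := by
  rcases hx.lt_or_gt with hx | hx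
  · simp [gammaPDF_of_neg hx]
  have hmoment : 0 < (ascPochhammer ℝ k).eval a := ascPochhammer_pos k a ha
  have := Real.Gamma_pos_of_pos ha
  rw [gammaPDF, gammaPDF, ← ENNReal.ofReal_mul (gammaPDFReal_nonneg ha hr x),
    ← ENNReal.ofReal_mul (by positivity)]
  congr 1
  simp only [gammaPDFReal, hx.le, if_true]
  rw [Gamma_add_natCast_eq_ascPochhammer_mul ha, add_sub_right_comm, Real.rpow_add hx,
    Real.rpow_add hr, Real.rpow_natCast, Real.rpow_natCast]
  field_simp

lemma measurable_gammaPDF (a r : ℝ) : Measurable (gammaPDF a r) :=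
  (measurable_gammaPDFReal a r).ennreal_ofReal

lemma lintegral_pow_gammaMeasure {a r : ℝ} (ha : 0 < a) (hr : 0 < r) (k : ℕ) :
    ∫⁻ x, ENNReal.ofReal (x ^ k) ∂(gammaMeasure a r) =
      ENNReal.ofReal ((ascPochhammer ℝ k).eval a / r ^ k) := by
  have hsize : (fun x => gammaPDF a r x * ENNReal.ofReal (x ^ k)) =ᵐ[volume]
      fun x => ENNReal.ofReal ((ascPochhammer ℝ k).eval a / r ^ k) * gammaPDF (a + k) r x := by
    filter_upwards [Measure.ae_ne volume 0] with x hx using gammaPDF_mul_ofReal_pow ha hr hx k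
  rw [gammaMeasure,
    lintegral_withDensity_eq_lintegral_mul _ (measurable_gammaPDF a r) (by fun_prop)]
  simp only [Pi.mul_apply]
  rw [lintegral_congr_ae hsize, lintegral_const_mul _ (measurable_gammaPDF _ r),
    lintegral_gammaPDF_eq_one (by positivity) hr, mul_one]

lemma ae_nonneg_gammaMeasure (a r : ℝ) : ∀ᵐ x ∂(gammaMeasure a r), 0 ≤ x := by
  rw [gammaMeasure, ae_withDensity_iff (measurable_gammaPDF a r)]
  exact ae_of_all _ fun x hx => le_of_not_gt fun hneg => hx (gammaPDF_of_neg hneg)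

lemma ae_nonneg_pow_gammaMeasure (a r : ℝ) (k : ℕ) :
    0 ≤ᵐ[gammaMeasure a r] fun x => x ^ k := by
  filter_upwards [ae_nonneg_gammaMeasure a r] with x hx using pow_nonneg hx k

lemma integrable_pow_gammaMeasure {a r : ℝ} (ha : 0 < a) (hr : 0 < r) (k : ℕ) :
    Integrable (fun x => x ^ k) (gammaMeasure a r) := by
  refine (lintegral_ofReal_ne_top_iff_integrable (by fun_prop)
    (ae_nonneg_pow_gammaMeasure a r k)).1 ?_
  simp [lintegral_pow_gammaMeasure ha hr]

lemma integral_pow_gammaMeasure {a r : ℝ} (ha : 0 < a) (hr : 0 < r) (k : ℕ) :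
    ∫ x, x ^ k ∂(gammaMeasure a r) = (ascPochhammer ℝ k).eval a / r ^ k := by
  have hmoment : 0 < (ascPochhammer ℝ k).eval a := ascPochhammer_pos k a ha
  rw [integral_eq_lintegral_of_nonneg_ae (ae_nonneg_pow_gammaMeasure a r k) (by fun_prop),
    lintegral_pow_gammaMeasure ha hr, ENNReal.toReal_ofReal (by positivity)]

variable {a b : ℝ}

lemma isProbabilityMeasure_symmetricVarianceGamma (ha : 0 < a) (m b : ℝ) :
    IsProbabilityMeasure (symmetricVarianceGamma m a b) := by
  have := isProbabilityMeasure_gammaMeasure ha one_pos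
  exact Measure.isProbabilityMeasure_map (by fun_prop)

lemma ae_sqrt_mul_mul_pow_eq (a : ℝ) (hb : 0 ≤ b) (k : ℕ) :
    (fun p : ℝ × ℝ => b ^ k * p.1 ^ k * p.2 ^ (2 * k))
      =ᵐ[(gammaMeasure a 1).prod (gaussianReal 0 1)]
      fun p => (0 + √(b * p.1) * p.2) ^ (2 * k) := by
  filter_upwards [Measure.quasiMeasurePreserving_fst.ae (ae_nonneg_gammaMeasure a 1)] with p hp
  rw [zero_add, mul_pow √(b * p.1), pow_mul √(b * p.1), Real.sq_sqrt (mul_nonneg hb hp), mul_pow b]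

lemma integrable_even_pow_symmetricVarianceGamma (ha : 0 < a) (hb : 0 ≤ b) (k : ℕ) :
    Integrable (fun x => x ^ (2 * k)) (symmetricVarianceGamma 0 a b) := by
  have := isProbabilityMeasure_gammaMeasure ha one_pos
  rw [symmetricVarianceGamma, integrable_map_measure (by fun_prop) (by fun_prop)]
  exact (((integrable_pow_gammaMeasure ha one_pos k).const_mul (b ^ k)).mul_prod
    (integrable_pow_gaussianReal 0 1 (2 * k))).congr (ae_sqrt_mul_mul_pow_eq a hb k)

lemma integral_even_pow_symmetricVarianceGamma (ha : 0 < a) (hb : 0 ≤ b) (k : ℕ) :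
    ∫ x, x ^ (2 * k) ∂(symmetricVarianceGamma 0 a b) =
      b ^ k * (ascPochhammer ℝ k).eval a * (2 * k - 1)‼ := by
  have := isProbabilityMeasure_gammaMeasure ha one_pos
  rw [symmetricVarianceGamma, integral_map (by fun_prop) (by fun_prop),
    ← integral_congr_ae (ae_sqrt_mul_mul_pow_eq a hb k),
    integral_prod_mul (fun x : ℝ => b ^ k * x ^ k) (fun y : ℝ => y ^ (2 * k)), integral_const_mul,
    integral_pow_gammaMeasure ha one_pos, integral_even_pow_gaussianReal]
  simp

end Moments

lemma hasFDerivAt_div_of_ne_zero {E : Type*} [NormedAddCommGroup E] [NormedSpace ℝ E]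
    {f g : E → ℝ} {f' g' : E →L[ℝ] ℝ} {x : E} (hf : HasFDerivAt f f' x) (hg : HasFDerivAt g g' x)
    (hx : g x ≠ 0) :
    HasFDerivAt (fun y => f y / g y) ((g x)⁻¹ • f' - (f x / g x ^ 2) • g') x := by
  simp_rw [div_eq_mul_inv]
  refine (hf.mul ((hasDerivAt_inv hx).comp_hasFDerivAt x hg)).congr_fderiv ?_
  ext v
  simp only [Function.comp_apply, add_apply, smul_apply, smul_eq_mul, neg_smul, smul_neg,
    neg_apply, sub_apply]
  ring

section VarianceGammaEstimators

/-- The statistics `x²` and `x⁴` whose averages are the empirical moments entering the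
estimators. -/
def evenMonomial (i : Fin 2) (x : ℝ) : ℝ := x ^ (2 * (i + 1 : ℕ))

/-- The map expressing the shape and scale parameters through the second and fourth moments
`y 0` and `y 1`; at a pair of empirical moments it gives the two estimators. -/
noncomputable def shapeScaleOfMoments (y : EuclideanSpace ℝ (Fin 2)) : EuclideanSpace ℝ (Fin 2) :=
  !₂[3 * y 0 ^ 2 / (y 1 - 3 * y 0 ^ 2), y 1 / (3 * y 0) - y 0]

/-- The Jacobian matrix of `shapeScaleOfMoments` at the moments of the symmetric variance-gamma
distribution with shape `a` and scale `b`. -/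
noncomputable def shapeScaleJacobian (a b : ℝ) : Matrix (Fin 2) (Fin 2) ℝ :=
  !![2 * (a + 1) / b, -1 / (3 * b ^ 2); -(2 * a + 1) / a, 1 / (3 * a * b)]

lemma measurable_evenMonomial (i : Fin 2) : Measurable (evenMonomial i) := by
  unfold evenMonomial
  fun_prop

lemma measurable_shapeScaleOfMoments : Measurable shapeScaleOfMoments := by
  refine (PiLp.continuous_toLp 2 _).measurable.comp (measurable_pi_lambda _ fun i => ?_)
  fin_cases i
  · simp only [Fin.zero_eta, Matrix.cons_val_zero]
    fun_prop
  · simp only [Fin.mk_one, Matrix.cons_val_one]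
    fun_prop

lemma shapeScaleOfMoments_empiricalMean {Ω : Type*} (X : ℕ → Ω → ℝ) (N : ℕ) (ω : Ω) :
    shapeScaleOfMoments (empiricalMean evenMonomial X N ω) =
      !₂[shapeEstimator X N ω, scaleEstimator X N ω] := by
  simp [shapeScaleOfMoments, empiricalMean, evenMonomial, shapeEstimator, scaleEstimator,
    empiricalRawMoment]

variable {a b : ℝ}

lemma memLp_evenMonomial (ha : 0 < a) (hb : 0 ≤ b) (i : Fin 2) :
    MemLp (evenMonomial i) 2 (symmetricVarianceGamma 0 a b) := by
  refine (memLp_two_iff_integrable_sq (measurable_evenMonomial i).aestronglyMeasurable).2 ?_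
  convert integrable_even_pow_symmetricVarianceGamma ha hb (2 * (i + 1)) using 2 with x
  rw [evenMonomial, ← pow_mul]
  ring

lemma meanVector_evenMonomial (ha : 0 < a) (hb : 0 ≤ b) :
    meanVector evenMonomial (symmetricVarianceGamma 0 a b) =
      !₂[a * b, 3 * b ^ 2 * (a * (a + 1))] := by
  ext i
  simp only [meanVector, evenMonomial, integral_even_pow_symmetricVarianceGamma ha hb]
  fin_cases i
  · simp [mul_comm]
  · simp only [ascPochhammer_succ_eval, ascPochhammer_zero, Polynomial.eval_one,
      Nat.doubleFactorial, Nat.reduceAdd, Nat.reduceMul, Nat.reduceSub, Fin.mk_one, Fin.isValue,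
      Matrix.cons_val]
    push_cast
    ring

lemma covarianceMatrix_evenMonomial (ha : 0 < a) (hb : 0 ≤ b) :
    covarianceMatrix evenMonomial (symmetricVarianceGamma 0 a b) =
      !![b ^ 2 * (2 * a ^ 2 + 3 * a), 6 * a * b ^ 3 * (a + 1) * (2 * a + 5);
        6 * a * b ^ 3 * (a + 1) * (2 * a + 5),
          3 * b ^ 4 * a * (a + 1) * (32 * a ^ 2 + 172 * a + 210)] := by
  have := isProbabilityMeasure_symmetricVarianceGamma ha 0 b
  have hL := memLp_evenMonomial ha hb
  have hcov (i j : Fin 2) : covarianceMatrix evenMonomial (symmetricVarianceGamma 0 a b) i j =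
      ∫ x, x ^ (2 * (i + j + 2 : ℕ)) ∂(symmetricVarianceGamma 0 a b) -
        (∫ x, x ^ (2 * (i + 1 : ℕ)) ∂(symmetricVarianceGamma 0 a b)) *
          ∫ x, x ^ (2 * (j + 1 : ℕ)) ∂(symmetricVarianceGamma 0 a b) := by
    rw [covarianceMatrix, Matrix.of_apply, covariance_eq_sub (hL i) (hL j)]
    simp only [evenMonomial, Pi.mul_apply, ← pow_add]
    ring_nf
  ext i j
  simp only [hcov, integral_even_pow_symmetricVarianceGamma ha hb]
  fin_cases i <;> fin_cases j <;>
  · simp only [ascPochhammer_succ_eval, ascPochhammer_zero, Polynomial.eval_one,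
      Nat.doubleFactorial, Nat.reduceAdd, Nat.reduceMul, Nat.reduceSub, Fin.zero_eta, Fin.mk_one,
      Fin.isValue, Matrix.of_apply, Matrix.cons_val', Matrix.cons_val]
    push_cast
    ring

lemma shapeScaleOfMoments_meanVector (ha : 0 < a) (hb : 0 < b) :
    shapeScaleOfMoments (meanVector evenMonomial (symmetricVarianceGamma 0 a b)) = !₂[a, b] := by
  have hexcess : 3 * b ^ 2 * (a * (a + 1)) - 3 * (a * b) ^ 2 = 3 * b ^ 2 * a := by ring
  rw [meanVector_evenMonomial ha hb.le]
  ext i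
  fin_cases i
  · simp only [shapeScaleOfMoments, Fin.zero_eta, PiLp.toLp_apply, Matrix.cons_val_zero,
      Matrix.cons_val_one, hexcess]
    field_simp
  · simp only [shapeScaleOfMoments, Fin.mk_one, PiLp.toLp_apply, Matrix.cons_val_zero,
      Matrix.cons_val_one]
    field_simp
    ring

lemma hasFDerivAt_shapeScaleOfMoments (ha : 0 < a) (hb : 0 < b) :
    HasFDerivAt shapeScaleOfMoments
      (shapeScaleJacobian a b).toEuclideanLin.toContinuousLinearMap
      (meanVector evenMonomial (symmetricVarianceGamma 0 a b)) := by
  have hexcess : 3 * b ^ 2 * (a * (a + 1)) - 3 * (a * b) ^ 2 = 3 * b ^ 2 * a := by ring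
  rw [meanVector_evenMonomial ha hb.le]
  set m : EuclideanSpace ℝ (Fin 2) := !₂[a * b, 3 * b ^ 2 * (a * (a + 1))] with hm
  have hcoord (i : Fin 2) := (EuclideanSpace.proj (𝕜 := ℝ) i).hasFDerivAt (x := m)
  refine hasFDerivWithinAt_univ.1 (hasFDerivWithinAt_euclidean.2 fun i =>
    HasFDerivAt.hasFDerivWithinAt ?_)
  fin_cases i
  · have hnum := ((hcoord 0).pow 2).const_mul 3
    have hden : m 1 - 3 * m 0 ^ 2 ≠ 0 := by
      simp only [hm, PiLp.toLp_apply, Matrix.cons_val_zero, Matrix.cons_val_one, hexcess]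
      positivity
    refine (hasFDerivAt_div_of_ne_zero hnum ((hcoord 1).sub hnum) hden).congr_fderiv ?_
    ext v
    simp only [shapeScaleJacobian, hm, EuclideanSpace.coe_proj, PiLp.proj_apply, Pi.sub_apply,
      ContinuousLinearMap.comp_apply, LinearMap.coe_toContinuousLinearMap', Matrix.toLpLin_apply,
      Matrix.cons_mulVec, dotProduct, Fin.sum_univ_two, Matrix.cons_val, sub_apply, smul_apply,
      smul_eq_mul, nsmul_eq_mul, Nat.cast_ofNat, Nat.add_one_sub_one, pow_one, Fin.zero_eta,
      hexcess]
    field_simp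
    ring
  · have hden : 3 * m 0 ≠ 0 := by
      simp only [hm, PiLp.toLp_apply, Matrix.cons_val_zero]
      positivity
    refine ((hasFDerivAt_div_of_ne_zero (hcoord 1) ((hcoord 0).const_mul 3) hden).sub
      (hcoord 0)).congr_fderiv ?_
    ext v
    simp only [shapeScaleJacobian, hm, PiLp.proj_apply, ContinuousLinearMap.comp_apply,
      LinearMap.coe_toContinuousLinearMap', Matrix.toLpLin_apply, Matrix.cons_mulVec, dotProduct,
      Fin.sum_univ_two, Matrix.cons_val, sub_apply, smul_apply, smul_eq_mul, Fin.mk_one]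
    field_simp
    ring

lemma shapeScaleJacobian_mul_covarianceMatrix_mul_transpose (ha : 0 < a) (hb : 0 < b) :
    shapeScaleJacobian a b * covarianceMatrix evenMonomial (symmetricVarianceGamma 0 a b) *
      (shapeScaleJacobian a b)ᵀ = limitCovariance a b := by
  rw [covarianceMatrix_evenMonomial ha hb.le]
  ext i j
  fin_cases i <;> fin_cases j <;>
  · simp only [shapeScaleJacobian, limitCovariance, Matrix.mul_apply, Matrix.transpose_apply,
      Matrix.smul_apply, Matrix.of_apply, Matrix.cons_val', Matrix.cons_val, Fin.sum_univ_two,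
      Fin.zero_eta, Fin.mk_one, smul_eq_mul]
    field_simp
    ring

end VarianceGammaEstimators

theorem theorem3 {Ω : Type*} [MeasurableSpace Ω] (P : Measure Ω) [IsProbabilityMeasure P]
    (a b : ℝ) (ha : 0 < a) (hb : 0 < b) (X : ℕ → Ω → ℝ)
    (hindep : iIndepFun X P)
    (hlaw : ∀ i, HasLaw (X i) (symmetricVarianceGamma 0 a b) P) :
    (limitCovariance a b).PosSemidef ∧
    TendstoInDistribution
      (fun (N : ℕ) (ω : Ω) =>
        √(N : ℝ) • (!₂[shapeEstimator X N ω, scaleEstimator X N ω] - !₂[a, b] :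
          EuclideanSpace ℝ (Fin 2)))
      atTop (id : EuclideanSpace ℝ (Fin 2) → EuclideanSpace ℝ (Fin 2))
      (fun _ => P) (multivariateGaussian 0 (limitCovariance a b)) := by
  rw [← shapeScaleJacobian_mul_covarianceMatrix_mul_transpose ha hb]
  have hL := memLp_evenMonomial ha hb.le
  have := isProbabilityMeasure_symmetricVarianceGamma ha 0 b
  constructor
  · simpa using
      (posSemidef_covarianceMatrix hL).mul_mul_conjTranspose_same (shapeScaleJacobian a b)
  · have hdelta := tendstoInDistribution_sqrt_smul_comp_empiricalMean_sub measurable_evenMonomial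
      hL hindep hlaw measurable_shapeScaleOfMoments (hasFDerivAt_shapeScaleOfMoments ha hb)
    simpa only [shapeScaleOfMoments_empiricalMean, shapeScaleOfMoments_meanVector ha hb]
      using hdelta
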